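/- Let $2\le k\le n$ be integers and $0=n_0<n_1<\dots<n_{k-1}<n_k=n$ be integers, and put $r_j=n_j-n_{j-1}$ for $j=1,\dots,k$. Let $a<b$ be real numbers. For $p,q>0$ let $\widetilde{beta}(p,q)$ denote the beta distribution on $[a,b]$, with density $$f_{p,q}(x)=\frac{1}{B(p,q)(b-a)^{p+q-1}}(x-a)^{p-1}(b-x)^{q-1}\quad (a<x<b),\qquad f_{p,q}(x)=0\ \text{ otherwise},$$ where $B(p,q)=\Gamma(p)\Gamma(q)/\Gamma(p+q)$. Let $U_1,\dots,U_{n-1}$ be independent random variables uniformly distributed on $(0,1)$, with order statistics $U_{(1)}\le\dots\le U_{(n-1)}$, and set $U_{(0)}=0$, $U_{(n)}=1$. Let $s_1,\dots,s_k$ be real numbers with $0<s_j<r_j$, and let $X_1,\dots,X_k$ be independent random variables such that $X_j$ has the distribution $\widetilde{beta}(s_j,r_j-s_j)$; assume that $(X_1,\dots,X_k)$ is independent of $(U_1,\dots,U_{n-1})$. Then the randomly weighted average $$S_{n:n_1,\dots,n_{k-1}}=\sum_{j=1}^{k}\bigl(U_{(n_j)}-U_{(n_{j-1})}\bigr)X_j$$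 has the distribution $\widetilde{beta}\Bigl(\sum_{j=1}^k s_j,\ \sum_{j=1}^k r_j-\sum_{j=1}^k s_j\Bigr)$. -/

import Mathlib

open MeasureTheory ProbabilityTheory

namespace RWA

/-- The density of the beta distribution with parameters `p, q` on the interval `[a, b]`. -/
noncomputable def betaPDFOn (a b p q x : ℝ) : ℝ :=
  if a < x ∧ x < b then
    1 / (beta p q * (b - a) ^ (p + q - 1)) * (x - a) ^ (p - 1) * (b - x) ^ (q - 1)
  else 0

/-- The beta distribution with parameters `p, q` on the interval `[a, b]`. -/
noncomputable def betaOn (a b p q : ℝ) : Measure ℝ :=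
  volume.withDensity fun x => ENNReal.ofReal (betaPDFOn a b p q x)

/-- The order statistics of a sample `u` of size `N`: its values in increasing order. The value at
index `i` (counted from zero) is the `(i + 1)`-st smallest one. -/
noncomputable def orderStat {N : ℕ} (u : Fin N → ℝ) : Fin N → ℝ :=
  u ∘ Tuple.sort u

/-- The cut points of `(0, 1)` given by a sample `u` of size `N`: `cut u 0 = 0`, `cut u m` is the
`m`-th smallest value of the sample for `1 ≤ m ≤ N`, and `cut u (N + 1) = 1`. -/
noncomputable def cut {N : ℕ} (u : Fin N → ℝ) : ℕ → ℝ
  | 0 => 0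
  | m + 1 => if h : m < N then orderStat u ⟨m, h⟩ else 1

/-- The random weights: increments of the cut points along the selected indices
`ν 0 < ν 1 < ⋯ < ν k`. -/
noncomputable def weight {N k : ℕ} (ν : Fin (k + 1) → ℕ) (u : Fin N → ℝ) (j : Fin k) : ℝ :=
  cut u (ν j.succ) - cut u (ν j.castSucc)

/-- The randomly weighted average of `x` with the weights that the sample `u` gives. -/
noncomputable def weightedAverage {N k : ℕ} (ν : Fin (k + 1) → ℕ) (u : Fin N → ℝ) (x : Fin k → ℝ) : ℝ :=
  ∑ j, weight ν u j * x j

/-- The increments `r j` of the selected indices, as real numbers. -/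
noncomputable def incr {k : ℕ} (ν : Fin (k + 1) → ℕ) (j : Fin k) : ℝ :=
  (ν j.succ : ℝ) - (ν j.castSucc : ℝ)

end RWA

namespace RWA

/-! ### Power series with rising factorials -/

/-- The power series `∑ (s)_l / l! X ^ l`, that is, the expansion of `(1 - X) ^ (-s)`. -/
noncomputable def risingSeries (s : ℝ) : PowerSeries ℝ :=
  PowerSeries.mk fun l => (ascPochhammer ℝ l).eval s / (l.factorial : ℝ)

lemma risingSeries_eq_rescale (s : ℝ) :
    risingSeries s = PowerSeries.rescale (-1 : ℝ) (PowerSeries.binomialSeries ℝ (-s)) := by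
  ext l
  have h := Ring.factorial_nsmul_multichoose_eq_ascPochhammer s l
  rw [Polynomial.ascPochhammer_smeval_eq_eval, nsmul_eq_mul] at h
  rw [risingSeries, PowerSeries.coeff_mk, PowerSeries.coeff_rescale,
    PowerSeries.binomialSeries_coeff, Ring.choose_neg', ← h,
    mul_div_cancel_left₀ _ (by positivity)]
  rcases Nat.even_or_odd l with hl | hl
  · simp [hl.neg_one_pow, Int.negOnePow_even (l : ℤ) (by exact_mod_cast hl)]
  · simp [hl.neg_one_pow, Int.negOnePow_odd (l : ℤ) (by exact_mod_cast hl)]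

lemma risingSeries_add (s t : ℝ) :
    risingSeries (s + t) = risingSeries s * risingSeries t := by
  simp only [risingSeries_eq_rescale]
  rw [← map_mul, neg_add, PowerSeries.binomialSeries_add]

lemma risingSeries_zero : risingSeries 0 = 1 := by
  simp [risingSeries_eq_rescale]

lemma risingSeries_one : risingSeries 1 = PowerSeries.mk fun _ => 1 := by
  ext l
  rw [risingSeries, PowerSeries.coeff_mk, PowerSeries.coeff_mk, ascPochhammer_eval_one,
    div_self (by positivity)]

lemma risingSeries_sum {ι : Type*} (A : Finset ι) (s : ι → ℝ) :
    risingSeries (∑ j ∈ A, s j) = ∏ j ∈ A, risingSeries (s j) := by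
  classical
  induction A using Finset.induction_on with
  | empty => simp [risingSeries_zero]
  | insert i A hi ih => rw [Finset.sum_insert hi, Finset.prod_insert hi, risingSeries_add, ih]

lemma geometric_pow_eq_rescale_risingSeries (z : ℝ) (r : ℕ) :
    (PowerSeries.mk fun l => z ^ l) ^ r = PowerSeries.rescale z (risingSeries r) := by
  have h1 : (PowerSeries.mk fun l => z ^ l) = PowerSeries.rescale z (risingSeries 1) := by
    ext l
    simp [risingSeries_one]
  have h2 : (r : ℝ) = ∑ _j ∈ Finset.range r, (1 : ℝ) := by simp
  rw [h1, ← map_pow, h2, risingSeries_sum, Finset.prod_const, Finset.card_range]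

lemma coeff_prod_piAntidiag {ι : Type*} [DecidableEq ι] (f : ι → PowerSeries ℝ) (A : Finset ι)
    (m : ℕ) :
    PowerSeries.coeff m (∏ i ∈ A, f i) =
      ∑ β ∈ A.piAntidiag m, ∏ i ∈ A, PowerSeries.coeff (β i) (f i) := by
  rw [PowerSeries.coeff_prod]
  refine Finset.sum_bij (fun l _ => ⇑l) ?_ (fun _ _ _ _ h => DFunLike.coe_injective h) ?_
    (fun _ _ => rfl)
  · intro l hl
    rw [Finset.mem_finsuppAntidiag] at hl
    rw [Finset.mem_piAntidiag]
    exact ⟨hl.1, fun i hi => hl.2 (Finsupp.mem_support_iff.2 hi)⟩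
  · intro β hβ
    rw [Finset.mem_piAntidiag] at hβ
    refine ⟨Finsupp.onFinset A β hβ.2, ?_, by ext; simp⟩
    rw [Finset.mem_finsuppAntidiag]
    exact ⟨hβ.1, Finsupp.support_onFinset_subset⟩

/-! ### The beta distribution on an interval -/

lemma measurable_betaPDFOn (a b p q : ℝ) : Measurable (betaPDFOn a b p q) :=
  Measurable.ite measurableSet_Ioo (by fun_prop) (by fun_prop)

lemma betaPDFOn_nonneg {a b p q : ℝ} (hp : 0 < p) (hq : 0 < q) (x : ℝ) :
    0 ≤ betaPDFOn a b p q x := by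
  unfold betaPDFOn
  split_ifs with h
  · have h1 : 0 < x - a := sub_pos.2 h.1
    have h2 : 0 < b - x := sub_pos.2 h.2
    have h3 : 0 < b - a := by linarith
    have := beta_pos hp hq
    positivity
  · exact le_rfl

lemma betaPDFOn_affine {a b p q : ℝ} (hab : a < b) (y : ℝ) :
    betaPDFOn a b p q ((b - a) * y + a) = (b - a)⁻¹ * betaPDFReal p q y := by
  have hc : 0 < b - a := sub_pos.2 hab
  have e : (a < (b - a) * y + a ∧ (b - a) * y + a < b) ↔ (0 < y ∧ y < 1) := by
    constructor
    · rintro ⟨h1, h2⟩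
      exact ⟨by nlinarith, by nlinarith⟩
    · rintro ⟨h1, h2⟩
      exact ⟨by nlinarith, by nlinarith⟩
  unfold betaPDFOn betaPDFReal
  simp only [e]
  split_ifs with h
  · have e1 : (b - a) * y + a - a = (b - a) * y := by ring
    have e2 : b - ((b - a) * y + a) = (b - a) * (1 - y) := by ring
    rw [e1, e2, Real.mul_rpow hc.le h.1.le, Real.mul_rpow hc.le (by linarith [h.2])]
    have e3 : (b - a) ^ (p + q - 1) = (b - a) ^ (p - 1) * (b - a) ^ (q - 1) * (b - a) := by
      rw [← Real.rpow_add hc, ← Real.rpow_add_one hc.ne']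
      ring_nf
    rw [e3]
    have := (Real.rpow_pos_of_pos hc (p - 1)).ne'
    have := (Real.rpow_pos_of_pos hc (q - 1)).ne'
    by_cases hB : beta p q = 0
    · simp [hB]
    · field_simp
  · simp

lemma lintegral_betaPDFOn {a b p q : ℝ} (hab : a < b) (hp : 0 < p) (hq : 0 < q) :
    ∫⁻ x, ENNReal.ofReal (betaPDFOn a b p q x) = 1 := by
  have hc : 0 < b - a := sub_pos.2 hab
  have hm : Measurable fun x => ENNReal.ofReal (betaPDFOn a b p q (x + a)) :=
    ((measurable_betaPDFOn a b p q).comp (measurable_add_const a)).ennreal_ofReal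
  rw [← lintegral_add_right_eq_self (μ := volume) _ a, ← Real.smul_map_volume_mul_left hc.ne',
    lintegral_smul_measure, lintegral_map hm (by fun_prop)]
  simp_rw [betaPDFOn_affine hab, ENNReal.ofReal_mul (inv_nonneg.2 hc.le)]
  rw [lintegral_const_mul _ (by fun_prop)]
  have := lintegral_betaPDF_eq_one hp hq
  unfold betaPDF at this
  rw [this, abs_of_pos hc, smul_eq_mul, mul_one, ← ENNReal.ofReal_mul hc.le,
    mul_inv_cancel₀ hc.ne', ENNReal.ofReal_one]

lemma isProbabilityMeasure_betaOn {a b p q : ℝ} (hab : a < b) (hp : 0 < p) (hq : 0 < q) :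
    IsProbabilityMeasure (betaOn a b p q) where
  measure_univ := by simp [betaOn, lintegral_betaPDFOn hab hp hq]

lemma ae_betaOn_mem_Ioo (a b p q : ℝ) : ∀ᵐ x ∂betaOn a b p q, x ∈ Set.Ioo a b := by
  rw [betaOn, ae_withDensity_iff (measurable_betaPDFOn a b p q).ennreal_ofReal]
  refine Filter.Eventually.of_forall fun x hx => ?_
  by_contra h
  refine hx ?_
  rw [betaPDFOn, if_neg (show ¬(a < x ∧ x < b) from h), ENNReal.ofReal_zero]

lemma gamma_add_nat {p : ℝ} (hp : 0 < p) (m : ℕ) :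
    Real.Gamma (p + m) = (ascPochhammer ℝ m).eval p * Real.Gamma p := by
  induction m with
  | zero => simp
  | succ m ih =>
    have : p + m ≠ 0 := by positivity
    rw [Nat.cast_succ, ← add_assoc, Real.Gamma_add_one this, ih, ascPochhammer_succ_eval]
    ring

lemma pow_mul_betaPDFOn {a b p q : ℝ} (hab : a < b) (hp : 0 < p) (hq : 0 < q) (m : ℕ) (x : ℝ) :
    (x - a) ^ m * betaPDFOn a b p q x =
      (b - a) ^ m * ((ascPochhammer ℝ m).eval p / (ascPochhammer ℝ m).eval (p + q)) *
        betaPDFOn a b (p + m) q x := by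
  unfold betaPDFOn
  split_ifs with h
  · have hc : 0 < b - a := sub_pos.2 hab
    have h1 : 0 < x - a := sub_pos.2 h.1
    have e1 : (x - a) ^ (p + m - 1) = (x - a) ^ m * (x - a) ^ (p - 1) := by
      rw [← Real.rpow_natCast, ← Real.rpow_add h1]
      ring_nf
    have e2 : (b - a) ^ (p + m + q - 1) = (b - a) ^ m * (b - a) ^ (p + q - 1) := by
      rw [← Real.rpow_natCast, ← Real.rpow_add hc]
      ring_nf
    have e3 : beta (p + m) q =
        (ascPochhammer ℝ m).eval p / (ascPochhammer ℝ m).eval (p + q) * beta p q := by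
      have : p + m + q = p + q + m := by ring
      rw [beta, this, gamma_add_nat hp, gamma_add_nat (add_pos hp hq), beta]
      ring
    have p1 := ascPochhammer_pos m p hp
    have p2 := ascPochhammer_pos m (p + q) (add_pos hp hq)
    have p3 := beta_pos hp hq
    have p4 := Real.rpow_pos_of_pos hc (p + q - 1)
    rw [e1, e2, e3]
    field_simp
  · simp

lemma integral_betaOn_pow {a b p q : ℝ} (hab : a < b) (hp : 0 < p) (hq : 0 < q) (m : ℕ) :
    ∫ x, (x - a) ^ m ∂betaOn a b p q =
      (b - a) ^ m * ((ascPochhammer ℝ m).eval p / (ascPochhammer ℝ m).eval (p + q)) := by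
  have hpm : 0 < p + m := by positivity
  rw [betaOn, integral_withDensity_eq_integral_toReal_smul
    (measurable_betaPDFOn a b p q).ennreal_ofReal (by simp)]
  have h1 : ∫ x, betaPDFOn a b (p + m) q x = 1 := by
    rw [integral_eq_lintegral_of_nonneg_ae
      (Filter.Eventually.of_forall (betaPDFOn_nonneg hpm hq))
      (measurable_betaPDFOn a b (p + m) q).aestronglyMeasurable,
      lintegral_betaPDFOn hab hpm hq, ENNReal.toReal_one]
  simp_rw [ENNReal.toReal_ofReal (betaPDFOn_nonneg hp hq _), smul_eq_mul, mul_comm (betaPDFOn _ _ _ _ _),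
    pow_mul_betaPDFOn hab hp hq m]
  rw [integral_const_mul, h1, mul_one]

/-- The beta integral over `(0, t)` with natural exponents. -/
lemma lintegral_Ioo_pow_mul_pow {t : ℝ} (ht : 0 < t) (c d : ℕ) :
    ∫⁻ w, (Set.Ioo 0 t).indicator (fun w => ENNReal.ofReal (w ^ c * (t - w) ^ d)) w =
      ENNReal.ofReal (t ^ (c + d + 1) *
        ((c.factorial * d.factorial : ℝ) / ((c + d + 1).factorial : ℝ))) := by
  have hB : beta (c + 1) (d + 1) =
      (c.factorial * d.factorial : ℝ) / ((c + d + 1).factorial : ℝ) := by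
    have : (c + 1 + (d + 1) : ℝ) = ((c + d + 1 : ℕ) : ℝ) + 1 := by push_cast; ring
    rw [beta, this, Real.Gamma_nat_eq_factorial, Real.Gamma_nat_eq_factorial,
      Real.Gamma_nat_eq_factorial]
  have hB0 := beta_pos (α := c + 1) (β := d + 1) (by positivity) (by positivity)
  have key : ∀ w, (Set.Ioo 0 t).indicator (fun w => ENNReal.ofReal (w ^ c * (t - w) ^ d)) w =
      ENNReal.ofReal (t ^ (c + d + 1) * beta (c + 1) (d + 1)) *
        ENNReal.ofReal (betaPDFOn 0 t (c + 1) (d + 1) w) := by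
    intro w
    rw [← ENNReal.ofReal_mul (by positivity), betaPDFOn]
    by_cases hw : w ∈ Set.Ioo 0 t
    · have e : (c + 1 + (d + 1) - 1 : ℝ) = ((c + d + 1 : ℕ) : ℝ) := by push_cast; ring
      rw [Set.indicator_of_mem hw, if_pos ⟨hw.1, hw.2⟩, e, sub_zero, sub_zero, add_sub_cancel_right,
        add_sub_cancel_right, Real.rpow_natCast, Real.rpow_natCast, Real.rpow_natCast]
      congr 1
      field_simp
    · rw [Set.indicator_of_notMem hw, if_neg (show ¬(0 < w ∧ w < t) from hw)]
      simp
  simp_rw [key]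
  rw [lintegral_const_mul _ (measurable_betaPDFOn _ _ _ _).ennreal_ofReal,
    lintegral_betaPDFOn ht (by positivity) (by positivity), mul_one, hB]

/-! ### Moments determine a distribution on a bounded interval -/

lemma ext_of_forall_integral_sub_pow {μ μ' : Measure ℝ} [IsProbabilityMeasure μ]
    [IsProbabilityMeasure μ'] {a b : ℝ} (h : ∀ᵐ x ∂μ, x ∈ Set.Icc a b)
    (h' : ∀ᵐ x ∂μ', x ∈ Set.Icc a b)
    (hm : ∀ m : ℕ, ∫ x, (x - a) ^ m ∂μ = ∫ x, (x - a) ^ m ∂μ') : μ = μ' := by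
  have bdd : ∀ (κ : Measure ℝ) [IsProbabilityMeasure κ], (∀ᵐ x ∂κ, x ∈ Set.Icc a b) →
      ∀ f : ℝ → ℝ, Continuous f → Integrable f κ := by
    intro κ _ hκ f hf
    obtain ⟨C, hC⟩ := (isCompact_Icc (a := a) (b := b)).exists_bound_of_continuousOn hf.continuousOn
    exact Integrable.of_bound hf.aestronglyMeasurable C (hκ.mono fun x hx => hC x hx)
  have hpoly : ∀ p : Polynomial ℝ, ∫ x, p.eval (x - a) ∂μ = ∫ x, p.eval (x - a) ∂μ' := by
    intro p
    simp_rw [Polynomial.eval_eq_sum_range]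
    rw [integral_finsetSum _ fun i _ => bdd μ h _ (by fun_prop),
      integral_finsetSum _ fun i _ => bdd μ' h' _ (by fun_prop)]
    simp_rw [integral_const_mul, hm]
  refine ext_of_forall_integral_eq_of_IsFiniteMeasure fun f => ?_
  refine eq_of_forall_dist_le fun ε hε => ?_
  obtain ⟨p, hp⟩ := exists_polynomial_near_of_continuousOn a b f f.continuous.continuousOn
    (ε / 2) (by positivity)
  have close : ∀ (κ : Measure ℝ) [IsProbabilityMeasure κ], (∀ᵐ x ∂κ, x ∈ Set.Icc a b) →
      |∫ x, p.eval x ∂κ - ∫ x, f x ∂κ| ≤ ε / 2 := by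
    intro κ _ hκ
    rw [← integral_sub (bdd κ hκ _ p.continuous) (bdd κ hκ _ f.continuous)]
    have := norm_integral_le_of_norm_le_const (μ := κ) (f := fun x => p.eval x - f x) (C := ε / 2)
      (hκ.mono fun x hx => (hp x hx).le)
    simpa using this
  have e : ∫ x, p.eval x ∂μ = ∫ x, p.eval x ∂μ' := by
    have hx : ∀ x, (p.comp (Polynomial.X + Polynomial.C a)).eval (x - a) = p.eval x := by
      intro x
      rw [Polynomial.eval_comp, Polynomial.eval_add, Polynomial.eval_X, Polynomial.eval_C,
        sub_add_cancel]
    exact (integral_congr_ae (ae_of_all _ hx)).symm.trans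
      ((hpoly _).trans (integral_congr_ae (ae_of_all _ hx)))
  have c1 := close μ h
  have c2 := close μ' h'
  rw [e] at c1
  rw [Real.dist_eq]
  rw [abs_le] at *
  constructor <;> linarith [c1.1, c1.2, c2.1, c2.2]

/-! ### Integration over ordered samples -/

/-- The cut points `0, v 0, …, v (N - 1), t` of the interval `(0, t)`. -/
noncomputable def cutAt {N : ℕ} (v : Fin N → ℝ) (t : ℝ) : ℕ → ℝ
  | 0 => 0
  | m + 1 => if h : m < N then v ⟨m, h⟩ else t

/-- The strictly increasing tuples in the interval `(0, t)`. -/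
def orderedTuples (N : ℕ) (t : ℝ) : Set (Fin N → ℝ) :=
  {v | StrictMono v ∧ ∀ i, v i ∈ Set.Ioo 0 t}

/-- The monomial in the spacings of the cut points of `(0, t)` with exponents `α`. -/
noncomputable def spacingMonomial {N : ℕ} (α : ℕ → ℕ) (v : Fin N → ℝ) (t : ℝ) : ℝ :=
  ∏ i ∈ Finset.range (N + 1), (cutAt v t (i + 1) - cutAt v t i) ^ α i

lemma cut_eq_cutAt {N : ℕ} (u : Fin N → ℝ) : cut u = cutAt (orderStat u) 1 := by
  funext m
  cases m <;> rfl

lemma measurable_cutAt {N : ℕ} (m : ℕ) :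
    Measurable fun p : (Fin N → ℝ) × ℝ => cutAt p.1 p.2 m := by
  cases m with
  | zero => exact measurable_const
  | succ m =>
    simp only [cutAt]
    split_ifs <;> fun_prop

lemma measurable_spacingMonomial {N : ℕ} (α : ℕ → ℕ) :
    Measurable fun p : (Fin N → ℝ) × ℝ => spacingMonomial α p.1 p.2 := by
  unfold spacingMonomial
  exact Finset.measurable_prod _ fun i _ =>
    ((measurable_cutAt _).sub (measurable_cutAt _)).pow_const _

lemma measurableSet_orderedTuples_graph (N : ℕ) :
    MeasurableSet {p : (Fin N → ℝ) × ℝ | p.1 ∈ orderedTuples N p.2} := by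
  have : {p : (Fin N → ℝ) × ℝ | p.1 ∈ orderedTuples N p.2} =
      (⋂ i, ⋂ j, ⋂ (_ : i < j), {p | p.1 i < p.1 j}) ∩
        ⋂ i, ({p | 0 < p.1 i} ∩ {p | p.1 i < p.2}) := by
    ext p
    simp [orderedTuples, StrictMono]
  rw [this]
  refine MeasurableSet.inter ?_ ?_
  · exact MeasurableSet.iInter fun i => MeasurableSet.iInter fun j => MeasurableSet.iInter fun _ =>
      measurableSet_lt (by fun_prop) (by fun_prop)
  · exact MeasurableSet.iInter fun i => (measurableSet_lt (by fun_prop) (by fun_prop)).inter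
      (measurableSet_lt (by fun_prop) (by fun_prop))

lemma measurableSet_orderedTuples (N : ℕ) (t : ℝ) : MeasurableSet (orderedTuples N t) :=
  (measurableSet_orderedTuples_graph N).preimage (measurable_id.prodMk measurable_const)

lemma snoc_mem_orderedTuples_iff {N : ℕ} (v : Fin N → ℝ) (w t : ℝ) :
    (Fin.snoc v w : Fin (N + 1) → ℝ) ∈ orderedTuples (N + 1) t ↔
      w ∈ Set.Ioo 0 t ∧ v ∈ orderedTuples N w := by
  constructor
  · rintro ⟨h1, h2⟩
    refine ⟨by simpa using h2 (Fin.last N), fun i j hij => ?_, fun i => ⟨?_, ?_⟩⟩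
    · simpa using h1 (show i.castSucc < j.castSucc from hij)
    · simpa using (h2 i.castSucc).1
    · simpa using h1 (Fin.castSucc_lt_last i)
  · rintro ⟨hw, h1, h2⟩
    refine ⟨fun i j => ?_, fun i => ?_⟩
    · induction i using Fin.lastCases with
      | last => intro h; exact absurd h (Fin.le_last j).not_gt
      | cast i =>
        induction j using Fin.lastCases with
        | last => intro _; simpa using (h2 i).2
        | cast j => intro h; simpa using h1 (show i < j from h)
    · induction i using Fin.lastCases with
      | last => simpa using hw
      | cast i => simpa using ⟨(h2 i).1, (h2 i).2.trans hw.2⟩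

lemma cutAt_snoc_of_le {N : ℕ} (v : Fin N → ℝ) (w t : ℝ) {i : ℕ} (hi : i ≤ N + 1) :
    cutAt (Fin.snoc v w : Fin (N + 1) → ℝ) t i = cutAt v w i := by
  cases i with
  | zero => rfl
  | succ i =>
    have h : i < N + 1 := hi
    simp only [cutAt, dif_pos h]
    by_cases h' : i < N
    · rw [dif_pos h']
      exact Fin.snoc_castSucc (α := fun _ => ℝ) w v ⟨i, h'⟩
    · rw [dif_neg h']
      obtain rfl : i = N := by omega
      exact Fin.snoc_last (α := fun _ => ℝ) w v

lemma cutAt_last {N : ℕ} (v : Fin N → ℝ) (t : ℝ) : cutAt v t (N + 1) = t := by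
  simp [cutAt]

lemma spacingMonomial_snoc {N : ℕ} (α : ℕ → ℕ) (v : Fin N → ℝ) (w t : ℝ) :
    spacingMonomial α (Fin.snoc v w : Fin (N + 1) → ℝ) t =
      spacingMonomial α v w * (t - w) ^ α (N + 1) := by
  unfold spacingMonomial
  rw [Finset.prod_range_succ]
  congr 1
  · refine Finset.prod_congr rfl fun i hi => ?_
    have := Finset.mem_range.1 hi
    rw [cutAt_snoc_of_le _ _ _ (by omega), cutAt_snoc_of_le _ _ _ (by omega)]
  · rw [cutAt_last, cutAt_snoc_of_le _ _ _ le_rfl, cutAt_last]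

lemma cutAt_le_cutAt_succ {N : ℕ} {v : Fin N → ℝ} {t : ℝ} (ht : 0 ≤ t) (hv : Monotone v)
    (h0 : ∀ i, v i ∈ Set.Icc 0 t) (i : ℕ) : cutAt v t i ≤ cutAt v t (i + 1) := by
  cases i with
  | zero =>
    simp only [cutAt]
    split_ifs
    · exact (h0 _).1
    · exact ht
  | succ i =>
    simp only [cutAt]
    split_ifs with h1 h2
    · exact hv (Nat.le_succ i)
    · exact (h0 _).2
    · omega
    · exact le_rfl

lemma spacingMonomial_nonneg {N : ℕ} (α : ℕ → ℕ) {v : Fin N → ℝ} {t : ℝ} (ht : 0 ≤ t)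
    (hv : Monotone v) (h0 : ∀ i, v i ∈ Set.Icc 0 t) : 0 ≤ spacingMonomial α v t :=
  Finset.prod_nonneg fun i _ => pow_nonneg (sub_nonneg.2 (cutAt_le_cutAt_succ ht hv h0 i)) _

lemma lintegral_fin_snoc {N : ℕ} {f : (Fin (N + 1) → ℝ) → ENNReal} (hf : Measurable f) :
    ∫⁻ u, f u = ∫⁻ w, ∫⁻ v, f (Fin.snoc v w) := by
  have hmp := (volume_preserving_piFinSuccAbove (fun _ : Fin (N + 1) => ℝ) (Fin.last N)).symm
  rw [← hmp.lintegral_comp hf, Measure.volume_eq_prod, lintegral_prod _ (by fun_prop)]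
  simp only [MeasurableEquiv.piFinSuccAbove_symm_apply, Fin.insertNthEquiv_last]
  rfl

/-- The Dirichlet integral over ordered tuples, with natural exponents. -/
lemma lintegral_spacingMonomial (α : ℕ → ℕ) (N : ℕ) {t : ℝ} (ht : 0 < t) :
    ∫⁻ v, (orderedTuples N t).indicator (fun v => ENNReal.ofReal (spacingMonomial α v t)) v =
      ENNReal.ofReal (t ^ (N + ∑ i ∈ Finset.range (N + 1), α i) *
        ((∏ i ∈ Finset.range (N + 1), ((α i).factorial : ℝ)) /
          ((N + ∑ i ∈ Finset.range (N + 1), α i).factorial : ℝ))) := by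
  induction N generalizing t with
  | zero =>
    have : ∀ v : Fin 0 → ℝ, v ∈ orderedTuples 0 t := fun v =>
      ⟨fun i => i.elim0, fun i => i.elim0⟩
    have h0 : ((α 0).factorial : ℝ) ≠ 0 := by positivity
    simp [this, spacingMonomial, cutAt, volume_pi, h0]
  | succ N ih =>
    set A := ∑ i ∈ Finset.range (N + 1), α i with hA
    set c : ℝ := (∏ i ∈ Finset.range (N + 1), ((α i).factorial : ℝ)) / ((N + A).factorial : ℝ)
      with hc
    have hc0 : 0 ≤ c := by positivity
    have hmeas : Measurable fun v : Fin (N + 1) → ℝ => (orderedTuples (N + 1) t).indicator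
        (fun v => ENNReal.ofReal (spacingMonomial α v t)) v :=
      (((measurable_spacingMonomial α).comp
        (measurable_id.prodMk measurable_const)).ennreal_ofReal).indicator
        (measurableSet_orderedTuples _ _)
    rw [lintegral_fin_snoc hmeas]
    have inner : ∀ w, ∫⁻ v : Fin N → ℝ, (orderedTuples (N + 1) t).indicator
        (fun v => ENNReal.ofReal (spacingMonomial α v t)) (Fin.snoc v w : Fin (N + 1) → ℝ) =
        ENNReal.ofReal c * (Set.Ioo 0 t).indicator
          (fun w => ENNReal.ofReal (w ^ (N + A) * (t - w) ^ α (N + 1))) w := by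
      intro w
      by_cases hw : w ∈ Set.Ioo 0 t
      · have hw' : 0 ≤ (t - w) ^ α (N + 1) := pow_nonneg (sub_nonneg.2 hw.2.le) _
        have : ∀ v : Fin N → ℝ, (orderedTuples (N + 1) t).indicator
            (fun v => ENNReal.ofReal (spacingMonomial α v t)) (Fin.snoc v w : Fin (N + 1) → ℝ) =
            ENNReal.ofReal ((t - w) ^ α (N + 1)) * (orderedTuples N w).indicator
              (fun v => ENNReal.ofReal (spacingMonomial α v w)) v := by
          intro v
          by_cases hv : v ∈ orderedTuples N w
          · rw [Set.indicator_of_mem ((snoc_mem_orderedTuples_iff v w t).2 ⟨hw, hv⟩),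
              Set.indicator_of_mem hv, spacingMonomial_snoc, mul_comm, ENNReal.ofReal_mul hw']
          · rw [Set.indicator_of_notMem
              (fun h => hv ((snoc_mem_orderedTuples_iff v w t).1 h).2),
              Set.indicator_of_notMem hv, mul_zero]
        simp_rw [this]
        rw [lintegral_const_mul' _ _ ENNReal.ofReal_ne_top, ih hw.1, Set.indicator_of_mem hw,
          ← ENNReal.ofReal_mul hw', ← ENNReal.ofReal_mul hc0]
        congr 1
        ring
      · have : ∀ v : Fin N → ℝ, (orderedTuples (N + 1) t).indicator
            (fun v => ENNReal.ofReal (spacingMonomial α v t)) (Fin.snoc v w : Fin (N + 1) → ℝ) =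
            0 := fun v => Set.indicator_of_notMem
              (fun h => hw ((snoc_mem_orderedTuples_iff v w t).1 h).1) _
        simp [this, hw]
    simp_rw [inner]
    rw [lintegral_const_mul' _ _ ENNReal.ofReal_ne_top, lintegral_Ioo_pow_mul_pow ht,
      ← ENNReal.ofReal_mul hc0, Finset.sum_range_succ, Finset.prod_range_succ, ← hA]
    have e : N + A + α (N + 1) + 1 = N + 1 + (A + α (N + 1)) := by ring
    rw [e, hc]
    congr 1
    field_simp

/-! ### Order statistics -/

lemma measurable_orderStat {N : ℕ} : Measurable (orderStat : (Fin N → ℝ) → Fin N → ℝ) := by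
  have hsort : ∀ σ : Equiv.Perm (Fin N), MeasurableSet {u : Fin N → ℝ | Tuple.sort u = σ} := by
    intro σ
    have : {u : Fin N → ℝ | Tuple.sort u = σ} = (⋂ i, ⋂ j, ⋂ (_ : i ≤ j), {u : Fin N → ℝ | u (σ i) ≤ u (σ j)}) ∩
        ⋂ i, ⋂ j, ⋂ (_ : i < j), ({u : Fin N → ℝ | u (σ i) = u (σ j)}ᶜ ∪ {_u | σ i < σ j}) := by
      ext u
      rw [Set.mem_ofPred_eq, eq_comm, Tuple.eq_sort_iff]
      simp [Monotone, imp_iff_not_or]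
    rw [this]
    refine MeasurableSet.inter ?_ ?_
    · exact MeasurableSet.iInter fun i => MeasurableSet.iInter fun j => MeasurableSet.iInter fun _ =>
        measurableSet_le (by fun_prop) (by fun_prop)
    · exact MeasurableSet.iInter fun i => MeasurableSet.iInter fun j => MeasurableSet.iInter fun _ =>
        (measurableSet_eq_fun (by fun_prop) (by fun_prop)).compl.union (MeasurableSet.const _)
  refine measurable_pi_lambda _ fun i => ?_
  have : (fun u : Fin N → ℝ => orderStat u i) =
      fun u => ∑ σ : Equiv.Perm (Fin N), ({u | Tuple.sort u = σ}).indicator (fun u => u (σ i)) u := by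
    funext u
    rw [Finset.sum_eq_single (Tuple.sort u)]
    · simp [orderStat]
    · intro σ _ hσ
      exact Set.indicator_of_notMem (fun h => hσ h.symm) _
    · simp
  rw [this]
  exact Finset.measurable_sum _ fun σ _ => (measurable_pi_apply _).indicator (hsort σ)

lemma monotone_orderStat {N : ℕ} (u : Fin N → ℝ) : Monotone (orderStat u) :=
  Tuple.monotone_sort u

lemma ae_injective (N : ℕ) : ∀ᵐ u : Fin N → ℝ, Function.Injective u := by
  have : ∀ i j : Fin N, i ≠ j → ∀ᵐ u : Fin N → ℝ, u i ≠ u j := by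
    intro i j hij
    let L : (Fin N → ℝ) →ₗ[ℝ] ℝ := 
      LinearMap.proj (R := ℝ) (φ := fun _ => ℝ) i - LinearMap.proj (R := ℝ) (φ := fun _ => ℝ) j
    have hL : LinearMap.ker L ≠ ⊤ := by
      intro h
      have : L (Pi.single i 1) = 0 := LinearMap.mem_ker.1 (h ▸ Submodule.mem_top)
      simp [L, hij] at this
    have := Measure.addHaar_submodule (volume : Measure (Fin N → ℝ)) _ hL
    refine measure_mono_null (fun u hu => ?_) this
    simpa [L, sub_eq_zero] using hu
  have h2 : ∀ᵐ u : Fin N → ℝ, ∀ i j : Fin N, i ≠ j → u i ≠ u j := by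
    rw [ae_all_iff]; intro i
    rw [ae_all_iff]; intro j
    exact Filter.eventually_imp_distrib_left.2 (this i j)
  filter_upwards [h2] with u hu i j hij
  by_contra h
  exact hu i j h hij

/-- The order statistics of an i.i.d. uniform sample are uniformly distributed over the ordered
tuples. -/
lemma lintegral_orderStat {N : ℕ} {F : (Fin N → ℝ) → ENNReal} (hF : Measurable F) :
    ∫⁻ u, F (orderStat u) ∂Measure.pi (fun _ : Fin N => volume.restrict (Set.Ioo (0 : ℝ) 1)) =
      N.factorial * ∫⁻ v, (orderedTuples N 1).indicator F v := by
  have hG : Measurable ((orderedTuples N 1).indicator F) :=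
    hF.indicator (measurableSet_orderedTuples N 1)
  rw [← Measure.restrict_pi_pi, ← volume_pi,
    ← lintegral_indicator (MeasurableSet.univ_pi fun _ => measurableSet_Ioo)]
  have key : ∀ᵐ u : Fin N → ℝ,
      (Set.univ.pi fun _ => Set.Ioo (0 : ℝ) 1).indicator (fun u => F (orderStat u)) u =
        ∑ σ : Equiv.Perm (Fin N), (orderedTuples N 1).indicator F (u ∘ σ) := by
    filter_upwards [ae_injective N] with u hu
    rw [Finset.sum_eq_single (Tuple.sort u)]
    · have hiff : u ∈ (Set.univ.pi fun _ => Set.Ioo (0 : ℝ) 1) ↔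
          u ∘ Tuple.sort u ∈ orderedTuples N 1 := by
        constructor
        · intro h
          exact ⟨(Tuple.monotone_sort u).strictMono_of_injective
            (hu.comp (Tuple.sort u).injective), fun i => h _ trivial⟩
        · intro h i _
          simpa using h.2 ((Tuple.sort u).symm i)
      by_cases h : u ∈ (Set.univ.pi fun _ => Set.Ioo (0 : ℝ) 1)
      · rw [Set.indicator_of_mem h, Set.indicator_of_mem (hiff.1 h)]
        rfl
      · rw [Set.indicator_of_notMem h, Set.indicator_of_notMem (fun h' => h (hiff.2 h'))]
    · intro σ _ hσ
      refine Set.indicator_of_notMem (fun h => hσ ?_) _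
      exact Tuple.eq_sort_iff.2 ⟨h.1.monotone, fun i j hij he => absurd (hu he)
        (σ.injective.ne hij.ne)⟩
    · simp
  rw [lintegral_congr_ae key, lintegral_finsetSum (μ := volume) _
    (f := fun (σ : Equiv.Perm (Fin N)) u => (orderedTuples N 1).indicator F (u ∘ σ)) fun σ _ =>
    hG.comp (measurable_pi_lambda _ fun i => measurable_pi_apply (σ i))]
  have hσ : ∀ σ : Equiv.Perm (Fin N), ∫⁻ u, (orderedTuples N 1).indicator F (u ∘ σ) =
      ∫⁻ v, (orderedTuples N 1).indicator F v := by
    intro σ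
    have := volume_measurePreserving_piCongrLeft (fun _ : Fin N => ℝ) σ.symm
    rw [← this.lintegral_comp hG]
    refine lintegral_congr fun u => ?_
    congr 1
    funext i
    have := MeasurableEquiv.piCongrLeft_apply_apply (β := fun _ : Fin N => ℝ) σ.symm u (σ i)
    simpa using this.symm
  simp_rw [hσ]
  simp [Fintype.card_perm]

/-! ### Moments of weighted averages with uniform spacings -/

/-- The law of a sample of `N` independent uniform variables on `(0, 1)`. -/
noncomputable def uniformSample (N : ℕ) : Measure (Fin N → ℝ) :=
  Measure.pi fun _ => volume.restrict (Set.Ioo (0 : ℝ) 1)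

instance (N : ℕ) : IsProbabilityMeasure (uniformSample N) := by
  have : IsProbabilityMeasure ((volume : Measure ℝ).restrict (Set.Ioo (0 : ℝ) 1)) :=
    ⟨by simp⟩
  unfold uniformSample
  infer_instance

lemma ae_uniformSample_mem_Ioo (N : ℕ) :
    ∀ᵐ u ∂uniformSample N, ∀ i, u i ∈ Set.Ioo (0 : ℝ) 1 := by
  rw [ae_all_iff]
  intro i
  exact Measure.tendsto_eval_ae_ae.eventually (ae_restrict_mem measurableSet_Ioo)

lemma orderStat_mem_Icc {N : ℕ} {u : Fin N → ℝ} (hu : ∀ i, u i ∈ Set.Ioo (0 : ℝ) 1) (i : Fin N) :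
    orderStat u i ∈ Set.Icc (0 : ℝ) 1 :=
  Set.Ioo_subset_Icc_self (hu _)

lemma measurable_cut {N : ℕ} (m : ℕ) : Measurable fun u : Fin N → ℝ => cut u m := by
  simp_rw [cut_eq_cutAt]
  exact (measurable_cutAt m).comp (measurable_orderStat.prodMk measurable_const)

lemma monotone_cut {N : ℕ} {u : Fin N → ℝ} (hu : ∀ i, u i ∈ Set.Ioo (0 : ℝ) 1) :
    Monotone (cut u) := by
  rw [cut_eq_cutAt]
  exact monotone_nat_of_le_succ
    (cutAt_le_cutAt_succ zero_le_one (monotone_orderStat u) (orderStat_mem_Icc hu))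

lemma spacingMonomial_orderStat_ae_nonneg (N : ℕ) (α : ℕ → ℕ) :
    0 ≤ᵐ[uniformSample N] fun u => spacingMonomial α (orderStat u) 1 := by
  filter_upwards [ae_uniformSample_mem_Ioo N] with u hu
  exact spacingMonomial_nonneg α zero_le_one (monotone_orderStat u) (orderStat_mem_Icc hu)

lemma measurable_spacingMonomial_orderStat (N : ℕ) (α : ℕ → ℕ) :
    Measurable fun u : Fin N → ℝ => spacingMonomial α (orderStat u) 1 :=
  (measurable_spacingMonomial α).comp (measurable_orderStat.prodMk measurable_const)

lemma lintegral_spacingMonomial_orderStat (N : ℕ) (α : ℕ → ℕ) :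
    ∫⁻ u, ENNReal.ofReal (spacingMonomial α (orderStat u) 1) ∂uniformSample N =
      ENNReal.ofReal (N.factorial * ((∏ i ∈ Finset.range (N + 1), ((α i).factorial : ℝ)) /
          ((N + ∑ i ∈ Finset.range (N + 1), α i).factorial : ℝ))) := by
  rw [uniformSample, lintegral_orderStat (F := fun v => ENNReal.ofReal (spacingMonomial α v 1))
    ((measurable_spacingMonomial α).comp (measurable_id.prodMk measurable_const)).ennreal_ofReal,
    lintegral_spacingMonomial α N one_pos, one_pow, one_mul, ENNReal.ofReal_mul (by positivity),
    ENNReal.ofReal_natCast]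

lemma integrable_spacingMonomial_orderStat (N : ℕ) (α : ℕ → ℕ) :
    Integrable (fun u => spacingMonomial α (orderStat u) 1) (uniformSample N) := by
  refine ⟨(measurable_spacingMonomial_orderStat N α).aestronglyMeasurable, ?_⟩
  rw [hasFiniteIntegral_iff_ofReal (spacingMonomial_orderStat_ae_nonneg N α),
    lintegral_spacingMonomial_orderStat]
  exact ENNReal.ofReal_lt_top

lemma integral_spacingMonomial_orderStat (N : ℕ) (α : ℕ → ℕ) :
    ∫ u, spacingMonomial α (orderStat u) 1 ∂uniformSample N =
      N.factorial * ((∏ i ∈ Finset.range (N + 1), ((α i).factorial : ℝ)) /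
          ((N + ∑ i ∈ Finset.range (N + 1), α i).factorial : ℝ)) := by
  rw [integral_eq_lintegral_of_nonneg_ae (spacingMonomial_orderStat_ae_nonneg N α)
    (measurable_spacingMonomial_orderStat N α).aestronglyMeasurable,
    lintegral_spacingMonomial_orderStat, ENNReal.toReal_ofReal (by positivity)]

/-- The moments of an average with uniform spacings as weights are, up to a factor, complete
homogeneous symmetric polynomials. -/
lemma integral_sum_spacing_mul_pow (N m : ℕ) (x : ℕ → ℝ) :
    ∫ u : Fin N → ℝ, (∑ i ∈ Finset.range (N + 1), (cut u (i + 1) - cut u i) * x i) ^ m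
        ∂uniformSample N =
      (m.factorial * N.factorial : ℝ) / ((N + m).factorial : ℝ) *
        PowerSeries.coeff m (∏ i ∈ Finset.range (N + 1), PowerSeries.mk fun l => x i ^ l) := by
  have expand : ∀ u : Fin N → ℝ,
      (∑ i ∈ Finset.range (N + 1), (cut u (i + 1) - cut u i) * x i) ^ m =
        ∑ α ∈ (Finset.range (N + 1)).piAntidiag m,
          (Nat.multinomial (Finset.range (N + 1)) α * ∏ i ∈ Finset.range (N + 1), x i ^ α i) *
            spacingMonomial α (orderStat u) 1 := by
    intro u
    rw [Finset.sum_pow_eq_sum_piAntidiag, cut_eq_cutAt]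
    refine Finset.sum_congr rfl fun α _ => ?_
    simp_rw [mul_pow]
    rw [Finset.prod_mul_distrib, spacingMonomial]
    ring
  simp_rw [expand]
  rw [integral_finsetSum _ fun α _ => (integrable_spacingMonomial_orderStat N α).const_mul _,
    coeff_prod_piAntidiag, Finset.mul_sum]
  refine Finset.sum_congr rfl fun α hα => ?_
  have hm : ∑ i ∈ Finset.range (N + 1), α i = m := (Finset.mem_piAntidiag.1 hα).1
  have hspec : (∏ i ∈ Finset.range (N + 1), ((α i).factorial : ℝ)) *
      Nat.multinomial (Finset.range (N + 1)) α = (m.factorial : ℝ) := by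
    rw [← hm]
    exact_mod_cast Nat.multinomial_spec (Finset.range (N + 1)) α
  rw [integral_const_mul, integral_spacingMonomial_orderStat, hm, ← hspec]
  simp_rw [PowerSeries.coeff_mk]
  ring

/-! ### Grouping the spacings into blocks -/

@[to_additive]
lemma prod_prod_Ico_of_monotone {M : Type*} [CommMonoid M] {k : ℕ} {ν : Fin (k + 1) → ℕ}
    (hν : Monotone ν) (g : ℕ → M) :
    ∏ j : Fin k, ∏ i ∈ Finset.Ico (ν j.castSucc) (ν j.succ), g i =
      ∏ i ∈ Finset.Ico (ν 0) (ν (Fin.last k)), g i := by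
  induction k with
  | zero => simp
  | succ k ih =>
    have h := ih (ν := fun j => ν j.castSucc) (fun i j hij => hν hij)
    rw [Fin.prod_univ_castSucc]
    simp only [Fin.succ_castSucc, Fin.succ_last]
    rw [h]
    exact Finset.prod_Ico_consecutive g (hν (Fin.zero_le _)) (hν (Fin.le_last _))

/-- The sequence that is constant with value `z j` on the block from `ν j` to `ν (j + 1)`. -/
noncomputable def blockwise {k : ℕ} (ν : Fin (k + 1) → ℕ) (z : Fin k → ℝ) (i : ℕ) : ℝ :=
  ∑ j, if i ∈ Finset.Ico (ν j.castSucc) (ν j.succ) then z j else 0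

lemma blockwise_of_mem {k : ℕ} {ν : Fin (k + 1) → ℕ} (hν : Monotone ν) (z : Fin k → ℝ) {i : ℕ}
    {j : Fin k} (hi : i ∈ Finset.Ico (ν j.castSucc) (ν j.succ)) : blockwise ν z i = z j := by
  unfold blockwise
  rw [Finset.sum_eq_single j, if_pos hi]
  · intro l _ hl
    refine if_neg fun hi' => ?_
    rw [Finset.mem_Ico] at hi hi'
    rcases lt_or_gt_of_ne hl with h | h
    · have := hν (show l.succ ≤ j.castSucc from h)
      omega
    · have := hν (show j.succ ≤ l.castSucc from h)
      omega
  · simp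

lemma weightedAverage_eq_sum_spacing {N k : ℕ} {ν : Fin (k + 1) → ℕ} (hν : Monotone ν)
    (hν0 : ν 0 = 0) (hνk : ν (Fin.last k) = N + 1) (u : Fin N → ℝ) (z : Fin k → ℝ) :
    weightedAverage ν u z =
      ∑ i ∈ Finset.range (N + 1), (cut u (i + 1) - cut u i) * blockwise ν z i := by
  rw [Finset.range_eq_Ico, ← hν0, ← hνk, ← sum_sum_Ico_of_monotone hν]
  refine Finset.sum_congr rfl fun j _ => ?_
  rw [weight, ← Finset.sum_Ico_sub _ (hν j.castSucc_lt_succ.le), Finset.sum_mul]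
  exact Finset.sum_congr rfl fun i hi => by rw [blockwise_of_mem hν z hi]

lemma sum_weight {N k : ℕ} {ν : Fin (k + 1) → ℕ} (hν : Monotone ν)
    (hν0 : ν 0 = 0) (hνk : ν (Fin.last k) = N + 1) (u : Fin N → ℝ) :
    ∑ j, weight ν u j = 1 := by
  have h : ∑ j, weight ν u j =
      ∑ j : Fin k, ∑ i ∈ Finset.Ico (ν j.castSucc) (ν j.succ), (cut u (i + 1) - cut u i) :=
    Finset.sum_congr rfl fun j _ =>
      (Finset.sum_Ico_sub (cut u) (hν j.castSucc_lt_succ.le)).symm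
  rw [h, sum_sum_Ico_of_monotone hν, Finset.sum_Ico_sub _ (hν (Fin.zero_le _)), hν0, hνk,
    cut_eq_cutAt, cutAt_last]
  simp [cutAt]

lemma weight_nonneg {N k : ℕ} {ν : Fin (k + 1) → ℕ} (hν : Monotone ν) {u : Fin N → ℝ}
    (hu : ∀ i, u i ∈ Set.Ioo (0 : ℝ) 1) (j : Fin k) : 0 ≤ weight ν u j :=
  sub_nonneg.2 (monotone_cut hu (hν j.castSucc_lt_succ.le))

lemma weightedAverage_sub_const {N k : ℕ} {ν : Fin (k + 1) → ℕ} (hν : Monotone ν)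
    (hν0 : ν 0 = 0) (hνk : ν (Fin.last k) = N + 1) (u : Fin N → ℝ) (x : Fin k → ℝ) (a : ℝ) :
    weightedAverage ν u x - a = weightedAverage ν u fun j => x j - a := by
  simp_rw [weightedAverage, mul_sub, Finset.sum_sub_distrib, ← Finset.sum_mul,
    sum_weight hν hν0 hνk u, one_mul]

lemma weightedAverage_mem_Icc {N k : ℕ} {ν : Fin (k + 1) → ℕ} (hν : Monotone ν)
    (hν0 : ν 0 = 0) (hνk : ν (Fin.last k) = N + 1) {u : Fin N → ℝ}
    (hu : ∀ i, u i ∈ Set.Ioo (0 : ℝ) 1) {x : Fin k → ℝ} {a b : ℝ}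
    (hx : ∀ j, x j ∈ Set.Icc a b) : weightedAverage ν u x ∈ Set.Icc a b :=
  (convex_Icc a b).sum_mem (fun j _ => weight_nonneg hν hu j) (sum_weight hν hν0 hνk u)
    (fun j _ => hx j)

lemma measurable_weightedAverage {N k : ℕ} (ν : Fin (k + 1) → ℕ) :
    Measurable fun p : (Fin N → ℝ) × (Fin k → ℝ) => weightedAverage ν p.1 p.2 := by
  unfold weightedAverage weight
  refine Finset.measurable_sum _ fun j _ => Measurable.mul ?_ (by fun_prop)
  exact ((measurable_cut _).comp measurable_fst).sub ((measurable_cut _).comp measurable_fst)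

lemma integral_weightedAverage_pow {N k : ℕ} {ν : Fin (k + 1) → ℕ} (hν : Monotone ν)
    (hν0 : ν 0 = 0) (hνk : ν (Fin.last k) = N + 1) (m : ℕ) (z : Fin k → ℝ) :
    ∫ u : Fin N → ℝ, weightedAverage ν u z ^ m ∂uniformSample N =
      (m.factorial * N.factorial : ℝ) / ((N + m).factorial : ℝ) *
        ∑ β ∈ (Finset.univ : Finset (Fin k)).piAntidiag m,
          ∏ j, z j ^ β j * PowerSeries.coeff (β j) (risingSeries (incr ν j)) := by
  simp_rw [weightedAverage_eq_sum_spacing hν hν0 hνk]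
  rw [integral_sum_spacing_mul_pow]
  congr 1
  have hblock : ∏ i ∈ Finset.range (N + 1), (PowerSeries.mk fun l => blockwise ν z i ^ l) =
      ∏ j, PowerSeries.rescale (z j) (risingSeries (incr ν j)) := by
    rw [Finset.range_eq_Ico, ← hν0, ← hνk, ← prod_prod_Ico_of_monotone hν]
    refine Finset.prod_congr rfl fun j _ => ?_
    have h : ∀ i ∈ Finset.Ico (ν j.castSucc) (ν j.succ),
        (PowerSeries.mk fun l => blockwise ν z i ^ l) = PowerSeries.mk fun l => z j ^ l :=
      fun i hi => by rw [blockwise_of_mem hν z hi]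
    rw [Finset.prod_congr rfl h, Finset.prod_const, Nat.card_Ico,
      geometric_pow_eq_rescale_risingSeries, incr, Nat.cast_sub (hν j.castSucc_lt_succ.le)]
  rw [hblock, coeff_prod_piAntidiag]
  simp_rw [PowerSeries.coeff_rescale]

/-! ### The distribution of the weighted average -/

lemma integral_betaOn_pow_mul_coeff {a b s r : ℝ} (hab : a < b) (hs : 0 < s) (hsr : s < r)
    (l : ℕ) :
    ∫ x, (x - a) ^ l * PowerSeries.coeff l (risingSeries r) ∂betaOn a b s (r - s) =
      (b - a) ^ l * PowerSeries.coeff l (risingSeries s) := by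
  have h := ascPochhammer_pos l r (hs.trans hsr)
  rw [integral_mul_const, integral_betaOn_pow hab hs (sub_pos.2 hsr), add_sub_cancel]
  simp_rw [risingSeries, PowerSeries.coeff_mk]
  field_simp

lemma integrable_betaOn_pow {a b p q : ℝ} [IsFiniteMeasure (betaOn a b p q)] (l : ℕ) :
    Integrable (fun x => (x - a) ^ l) (betaOn a b p q) := by
  refine Integrable.of_bound (by fun_prop) ((b - a) ^ l) ?_
  filter_upwards [ae_betaOn_mem_Ioo a b p q] with x hx
  rw [norm_pow, Real.norm_of_nonneg (sub_nonneg.2 hx.1.le)]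
  exact pow_le_pow_left₀ (sub_nonneg.2 hx.1.le) (by linarith [hx.2]) _

lemma hasLaw_weightedAverage {N k : ℕ} {ν : Fin (k + 1) → ℕ} (hk : 0 < k) (hν : Monotone ν)
    (hν0 : ν 0 = 0) (hνk : ν (Fin.last k) = N + 1) {a b : ℝ} (hab : a < b)
    {s : Fin k → ℝ} (hs : ∀ j, 0 < s j ∧ s j < incr ν j) :
    HasLaw (fun p : (Fin N → ℝ) × (Fin k → ℝ) => weightedAverage ν p.1 p.2)
      (betaOn a b (∑ j, s j) ((∑ j, incr ν j) - ∑ j, s j))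
      ((uniformSample N).prod (Measure.pi fun j => betaOn a b (s j) (incr ν j - s j))) := by
  have hprob : ∀ j, IsProbabilityMeasure (betaOn a b (s j) (incr ν j - s j)) := fun j =>
    isProbabilityMeasure_betaOn hab (hs j).1 (sub_pos.2 (hs j).2)
  have hne : (Finset.univ : Finset (Fin k)).Nonempty := ⟨⟨0, hk⟩, Finset.mem_univ _⟩
  have hs0 : 0 < ∑ j, s j := Finset.sum_pos (fun j _ => (hs j).1) hne
  have hs1 : 0 < (∑ j, incr ν j) - ∑ j, s j :=
    sub_pos.2 (Finset.sum_lt_sum_of_nonempty hne fun j _ => (hs j).2)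
  have hincr : ∑ j, incr ν j = N + 1 := by
    have h : ∑ j, incr ν j = ((∑ j : Fin k, (ν j.succ - ν j.castSucc) : ℕ) : ℝ) := by
      rw [Nat.cast_sum]
      exact Finset.sum_congr rfl fun j _ => (Nat.cast_sub (hν j.castSucc_lt_succ.le)).symm
    have h' := sum_sum_Ico_of_monotone hν fun _ => 1
    simp only [Finset.sum_const, Nat.card_Ico, smul_eq_mul, mul_one, hν0, hνk] at h'
    rw [h, h']
    push_cast
    ring
  have := isProbabilityMeasure_betaOn hab hs0 hs1
  set κ := Measure.pi fun j => betaOn a b (s j) (incr ν j - s j) with hκ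
  have hmeas := measurable_weightedAverage (N := N) ν
  have hae : ∀ᵐ p ∂(uniformSample N).prod κ,
      (∀ i, p.1 i ∈ Set.Ioo (0 : ℝ) 1) ∧ ∀ j, p.2 j ∈ Set.Icc a b := by
    have h1 := Measure.quasiMeasurePreserving_fst (μ := uniformSample N) (ν := κ) |>.ae
      (ae_uniformSample_mem_Ioo N)
    have h2 : ∀ᵐ x ∂κ, ∀ j, x j ∈ Set.Ioo a b := by
      rw [ae_all_iff]
      intro j
      exact Measure.tendsto_eval_ae_ae.eventually (ae_betaOn_mem_Ioo a b _ _)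
    have h3 := Measure.quasiMeasurePreserving_snd (μ := uniformSample N) (ν := κ) |>.ae h2
    filter_upwards [h1, h3] with p hp hp'
    exact ⟨hp, fun j => Set.Ioo_subset_Icc_self (hp' j)⟩
  have : IsProbabilityMeasure (((uniformSample N).prod κ).map
      fun p : (Fin N → ℝ) × (Fin k → ℝ) => weightedAverage ν p.1 p.2) :=
    Measure.isProbabilityMeasure_map hmeas.aemeasurable
  refine ⟨hmeas.aemeasurable, ext_of_forall_integral_sub_pow (a := a) (b := b) ?_ ?_ ?_⟩
  · refine (ae_map_iff hmeas.aemeasurable (p := fun x => x ∈ Set.Icc a b) measurableSet_Icc).2 ?_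
    filter_upwards [hae] with p hp
    exact weightedAverage_mem_Icc hν hν0 hνk hp.1 hp.2
  · exact (ae_betaOn_mem_Ioo a b _ _).mono fun x hx => Set.Ioo_subset_Icc_self hx
  intro m
  rw [integral_map hmeas.aemeasurable (by fun_prop), integral_betaOn_pow hab hs0 hs1,
    add_sub_cancel, hincr]
  have hint : Integrable (fun p : (Fin N → ℝ) × (Fin k → ℝ) => (weightedAverage ν p.1 p.2 - a) ^ m)
      ((uniformSample N).prod κ) := by
    refine Integrable.of_bound (by fun_prop) ((b - a) ^ m) ?_
    filter_upwards [hae] with p hp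
    have h := weightedAverage_mem_Icc hν hν0 hνk hp.1 hp.2
    rw [norm_pow, Real.norm_of_nonneg (sub_nonneg.2 h.1)]
    exact pow_le_pow_left₀ (sub_nonneg.2 h.1) (by linarith [h.2]) _
  rw [integral_prod_symm _ hint]
  simp_rw [weightedAverage_sub_const hν hν0 hνk, integral_weightedAverage_pow hν hν0 hνk]
  rw [integral_const_mul, integral_finsetSum _ fun β _ => Integrable.fintype_prod
    (f := fun j y => (y - a) ^ β j * PowerSeries.coeff (β j) (risingSeries (incr ν j)))
    fun j => (integrable_betaOn_pow (β j)).mul_const _]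
  have hβ : ∀ β ∈ (Finset.univ : Finset (Fin k)).piAntidiag m,
      ∫ x, ∏ j, (x j - a) ^ β j * PowerSeries.coeff (β j) (risingSeries (incr ν j)) ∂κ =
        (b - a) ^ m * ∏ j, PowerSeries.coeff (β j) (risingSeries (s j)) := by
    intro β hβ
    rw [hκ, integral_fintype_prod_eq_prod
      (fun j y => (y - a) ^ β j * PowerSeries.coeff (β j) (risingSeries (incr ν j)))]
    simp_rw [fun j => integral_betaOn_pow_mul_coeff hab (hs j).1 (hs j).2 (β j)]
    rw [Finset.prod_mul_distrib, Finset.prod_pow_eq_pow_sum, (Finset.mem_piAntidiag.1 hβ).1]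
  rw [Finset.sum_congr rfl hβ, ← Finset.mul_sum, ← coeff_prod_piAntidiag, ← risingSeries_sum,
    risingSeries, PowerSeries.coeff_mk]
  have hfac : ((N + m).factorial : ℝ) =
      N.factorial * (ascPochhammer ℝ m).eval (N + 1 : ℝ) := by
    rw [← Nat.factorial_mul_ascFactorial, ← ascPochhammer_nat_eq_ascFactorial]
    push_cast [ascPochhammer_eval_cast]
    rfl
  have hpos := ascPochhammer_pos m (N + 1 : ℝ) (by positivity)
  rw [hfac]
  field_simp

end RWA

theorem theorem3p2 {Ω : Type*} [MeasurableSpace Ω] (P : Measure Ω) [IsProbabilityMeasure P]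
    (n k : ℕ) (hk : 2 ≤ k)
    (ν : Fin (k + 1) → ℕ) (hν : StrictMono ν) (hν0 : ν 0 = 0) (hνk : ν (Fin.last k) = n)
    (a b : ℝ) (hab : a < b)
    (s : Fin k → ℝ) (hs : ∀ j, 0 < s j ∧ s j < RWA.incr ν j)
    (U : Fin (n - 1) → Ω → ℝ) (X : Fin k → Ω → ℝ)
    (hU : ∀ i, HasLaw (U i) (volume.restrict (Set.Ioo (0 : ℝ) 1)) P)
    (hUind : iIndepFun U P)
    (hX : ∀ j, HasLaw (X j) (RWA.betaOn a b (s j) (RWA.incr ν j - s j)) P)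
    (hXind : iIndepFun X P)
    (hUX : IndepFun (fun ω i => U i ω) (fun ω j => X j ω) P) :
    HasLaw (fun ω => RWA.weightedAverage ν (fun i => U i ω) (fun j => X j ω))
      (RWA.betaOn a b (∑ j, s j) ((∑ j, RWA.incr ν j) - ∑ j, s j)) P := by
  have hlt : ν 0 < ν (Fin.last k) := hν (show (0 : Fin (k + 1)).val < (Fin.last k).val by simp; omega)
  have hlast : ν (Fin.last k) = n - 1 + 1 := by omega
  exact (RWA.hasLaw_weightedAverage (by omega) hν.monotone hν0 hlast hab hs).comp
    ((indepFun_iff_hasLaw_prodMk_prod (hUind.hasLaw_pi hU) (hXind.hasLaw_pi hX)).1 hUX)
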